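/- Let $X(t)$, $t\in\mathbb R$, be a real-valued, centered, (wide-sense) stationary process with finite second moments, on a probability space, whose spectrum is bandlimited to $[-\Lambda,\Lambda)$, $\Lambda>0$; that is, its covariance function has the form $$B(\tau):=\mathbf E\,X(t+\tau)X(t)=\int_{[-\Lambda,\Lambda)}e^{i\tau\lambda}\,dF(\lambda),\qquad t,\tau\in\mathbb R,$$ with a finite Borel measure $F$ on $[-\Lambda,\Lambda)$. Let $\omega>\Lambda$ and, for $n\in\mathbb N$, put $$X_n(t):=\sum_{k=-n}^{n}\frac{\sin\left(\omega\left(t-\frac{k\pi}{\omega}\right)\right)}{\omega\left(t-\frac{k\pi}{\omega}\right)}\,X\!\left(\frac{k\pi}{\omega}\right),\qquad Y_n(t):=X(t)-X_n(t),$$ where the quotient is read as $1$ when $t=k\pi/\omega$. Let $z\in(0,1)$, $t>0$ and $s>0$. Then: 1. for every $n\ge\frac{\omega t}{\pi\sqrt z}$, $$\mathbf E\,|X(t)-X_n(t)|^2\le n^{-2}\,C_n(t),\qquad C_n(t):=B(0)\left(\frac{4\omega t}{\pi^2(1-z)}+\frac{4\left(z+1+\frac1n\right)}{\pi(1-z)^2\left(1-\frac{\Lambda}{\omega}\right)}\right)^2;$$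 2. for every $n\ge\frac{\omega}{\pi\sqrt z}\max(t,s)$, $$\mathbf E\,\bigl(Y_n(t)-Y_n(s)\bigr)^2\le\left(\frac{t-s}{n}\right)^2 b_n(t,s),\qquad b_n(t,s):=B(0)\left(W_n(t,s)+\frac{Q_n(t,s)}{1-\frac{\Lambda}{\omega}}\right)^2,$$ where $$W_n(t,s):=\frac{4\omega}{\pi^2(1-z)}\left(\omega s+1+\frac{\omega^2(s+t)s}{\pi^2n^2(1-z)}\right),\qquad Q_n(t,s):=\frac{2\omega}{\pi(1-z)^2}\left(z+1+n^{-1}+\frac{2\omega(s+t)}{n\pi^2}\right).$$ -/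

import Mathlib

open MeasureTheory

noncomputable section

/-- The covariance function `B(τ) = E X(τ) X(0)` of a real-valued process. For a stationary process
it equals `E X(t + τ) X(t)` for every `t`. -/
def covFun {Ω : Type*} [MeasurableSpace Ω] (P : Measure Ω) (X : ℝ → Ω → ℝ) (τ : ℝ) : ℝ :=
  ∫ o, X τ o * X 0 o ∂P

/-- A centered, real-valued, (wide-sense) stationary process with finite second moments. -/
structure IsCenteredStationary {Ω : Type*} [MeasurableSpace Ω] (P : Measure Ω)
    (X : ℝ → Ω → ℝ) : Prop where
  memLp_two : ∀ t, MemLp (X t) 2 P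
  mean_zero : ∀ t, ∫ o, X t o ∂P = 0
  stationary : ∀ t τ, ∫ o, X (t + τ) o * X t o ∂P = covFun P X τ

/-- `F` is the spectral measure of the process `X`: a finite Borel measure on the line with
`B(τ) = ∫ exp(i τ l) dF(l)` for all real `τ`. -/
def IsSpectralMeasure {Ω : Type*} [MeasurableSpace Ω] (P : Measure Ω) (X : ℝ → Ω → ℝ)
    (F : Measure ℝ) : Prop :=
  IsFiniteMeasure F ∧
    ∀ τ : ℝ, (covFun P X τ : ℂ) = ∫ l : ℝ, Complex.exp (Complex.I * τ * l) ∂F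

/-- The spectrum of `X` is bandlimited to `[-L, L)`: its spectral measure is concentrated there. -/
def IsBandlimited {Ω : Type*} [MeasurableSpace Ω] (P : Measure Ω) (X : ℝ → Ω → ℝ)
    (L : ℝ) : Prop :=
  ∃ F : Measure ℝ, IsSpectralMeasure P X F ∧ F (Set.Ico (-L) L)ᶜ = 0

/-- The truncated sampling sum
`X_n(t) = ∑_{k=-n}^{n} sin(ω(t - kπ/ω)) / (ω(t - kπ/ω)) * X(kπ/ω)`, where the quotient is
understood as `1` at `t = kπ/ω`. -/
def truncSum {Ω : Type*} (X : ℝ → Ω → ℝ) (ω : ℝ) (n : ℕ) (t : ℝ) (o : Ω) : ℝ :=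
  ∑ k ∈ Finset.Icc (-(n : ℤ)) (n : ℤ),
    Real.sinc (ω * (t - k * Real.pi / ω)) * X (k * Real.pi / ω) o

/-- The remainder `Y_n(t) = X(t) - X_n(t)`. -/
def remainder {Ω : Type*} (X : ℝ → Ω → ℝ) (ω : ℝ) (n : ℕ) (t : ℝ) (o : Ω) : ℝ :=
  X t o - truncSum X ω n t o

/-- `C_n(t)`, with `B0` standing for `B(0)` and `L` for the band limit. -/
def boundC (B0 L ω z : ℝ) (n : ℕ) (t : ℝ) : ℝ :=
  B0 * (4 * ω * t / (Real.pi ^ 2 * (1 - z)) +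
    4 * (z + 1 + 1 / (n : ℝ)) / (Real.pi * (1 - z) ^ 2 * (1 - L / ω))) ^ 2

/-- `W_n(t, s)`. -/
def boundW (ω z : ℝ) (n : ℕ) (t s : ℝ) : ℝ :=
  4 * ω / (Real.pi ^ 2 * (1 - z)) *
    (ω * s + 1 + ω ^ 2 * (s + t) * s / (Real.pi ^ 2 * (n : ℝ) ^ 2 * (1 - z)))

/-- `Q_n(t, s)`. -/
def boundQ (ω z : ℝ) (n : ℕ) (t s : ℝ) : ℝ :=
  2 * ω / (Real.pi * (1 - z) ^ 2) *
    (z + 1 + (n : ℝ)⁻¹ + 2 * ω * (s + t) / ((n : ℝ) * Real.pi ^ 2))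

/-- `b_n(t, s)`, with `B0` standing for `B(0)` and `L` for the band limit. -/
def boundb (B0 L ω z : ℝ) (n : ℕ) (t s : ℝ) : ℝ :=
  B0 * (boundW ω z n t s + boundQ ω z n t s / (1 - L / ω)) ^ 2

end

/-! `Y_n(t)` and `Y_n(t) - Y_n(s)` are finite real combinations of values of `X`, so by the spectral
representation of the covariance their second moments are the squared L²(F) norms of the same
combinations of `l ↦ exp(iul)`. Since `F` has mass `B(0)` and lives on the band, a uniform bound
over `|l| ≤ L` suffices (`IsCenteredStationary.integral_linearCombination_sq_le`).

With `x = ωt/π` and `θ = πl/ω`, the function to bound is the truncation error of `exp(ixθ) = ∑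
sinc(π(x-k)) exp(ikθ)`, valid for `|θ| < π` (`tendsto_sum_sinc_mul_cexp`). Pairing `k` with `-k`
turns the tail into `-(2 sin(πx)/π) ∑_{k>n} (-1)^k (x cos kθ + i k sin kθ)/(k²-x²)`. The cosine part
is absolutely summable and O(1/n). The sine coefficients are only of order `1/k` but decrease, so
Abel summation applies (`abs_sum_antitone_mul_sin_le`); its price is `|1+exp(iθ)|⁻¹`, which produces
the factor `1/(1-L/ω)`. Increments are treated by differencing the same tails. -/

/-! ### Pointwise convergence of the sampling series of an exponential -/

theorem integral_cexp_mul_I (y : ℝ) :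
    ∫ θ in (-Real.pi)..Real.pi, Complex.exp (Complex.I * y * θ) =
      2 * Real.pi * Real.sinc (Real.pi * y) := by
  have h := intervalIntegral.smul_integral_comp_mul_left (a := -Real.pi) (b := Real.pi)
    (fun t : ℝ => Complex.exp (t * Complex.I)) y
  by_cases hy : y = 0
  · subst hy; simp; ring
  have h2 := integral_exp_mul_I_eq_sinc (Real.pi * y)
  rw [mul_neg, mul_comm y, h2] at h
  have hy' : (y : ℂ) ≠ 0 := by exact_mod_cast hy
  apply mul_left_cancel₀ hy'
  have e : ∀ θ : ℝ, Complex.exp (Complex.I * y * θ) = Complex.exp ((y * θ : ℝ) * Complex.I) := by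
    intro θ; congr 1; push_cast; ring
  simp_rw [e]
  rw [Complex.real_smul] at h
  rw [h]; push_cast; ring

theorem sum_Icc_neg_succ {M : Type*} [AddCommMonoid M] (f : ℤ → M) (N : ℕ) :
    ∑ k ∈ Finset.Icc (-((N + 1 : ℕ) : ℤ)) ((N + 1 : ℕ) : ℤ), f k =
      ∑ k ∈ Finset.Icc (-(N : ℤ)) N, f k + (f (N + 1) + f (-(N + 1))) := by
  have : Finset.Icc (-((N + 1 : ℕ) : ℤ)) ((N + 1 : ℕ) : ℤ) =
      insert ((N : ℤ) + 1) (insert (-((N : ℤ) + 1)) (Finset.Icc (-(N : ℤ)) N)) := by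
    ext k; simp only [Finset.mem_Icc, Finset.mem_insert]; omega
  rw [this, Finset.sum_insert (by simp; omega), Finset.sum_insert (by simp)]
  rw [← add_assoc, add_comm]

/-- Summation by parts: multiplication by `1 + w` replaces `c k` by `c k + c (k - 1)`, up to two
boundary terms. -/
theorem one_add_mul_sum_Icc_neg (c : ℤ → ℂ) {w : ℂ} (hw : w ≠ 0) (N : ℕ) :
    ∑ k ∈ Finset.Icc (-(N : ℤ)) N, (c k + c (k - 1)) * w ^ k =
      (1 + w) * ∑ k ∈ Finset.Icc (-(N : ℤ)) N, c k * w ^ k +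
        (c (-N - 1) * w ^ (-N : ℤ) - c N * w ^ (N + 1 : ℤ)) := by
  induction N with
  | zero => simp; ring
  | succ N ih =>
    rw [sum_Icc_neg_succ, sum_Icc_neg_succ, ih]
    have e1 : (-((N + 1 : ℕ) : ℤ) - 1) = -((N : ℤ) + 1) - 1 := by push_cast; ring
    have e2 : (((N + 1 : ℕ) : ℤ)) = (N : ℤ) + 1 := by push_cast; ring
    have e3 : (-(N : ℤ) - 1) = -((N : ℤ) + 1) := by ring
    have e4 : w ^ (-(N : ℤ)) = w ^ (-((N : ℤ) + 1)) * w := by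
      rw [← zpow_add_one₀ hw]; congr 1; ring
    have e5 : w ^ ((N : ℤ) + 1 + 1) = w ^ ((N : ℤ) + 1) * w := by
      rw [← zpow_add_one₀ hw]
    have e6 : (N : ℤ) + 1 - 1 = N := by ring
    rw [e1, e2, e3, e4, e5, e6]
    ring

open Filter Topology in
theorem tendsto_sinc_cofinite (x : ℝ) :
    Tendsto (fun k : ℤ => Real.sinc (Real.pi * (x - k))) cofinite (𝓝 0) := by
  have h : (fun d : ℤ => (((-1 : ℤ) : ℂ) * x + d)⁻¹) =O[cofinite] fun n : ℤ => (n : ℝ)⁻¹ :=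
    EisensteinSeries.linear_inv_isBigO_right (-1) x
  have h0 : Tendsto (fun n : ℤ => (n : ℝ)⁻¹) cofinite (𝓝 0) := by
    have := tendsto_norm_comp_cofinite_atTop_of_isClosedEmbedding Int.isClosedEmbedding_coe_real
    rw [tendsto_zero_iff_norm_tendsto_zero]
    refine this.inv_tendsto_atTop.congr fun n => ?_
    simp
  have h1 := (h.trans_tendsto h0).norm
  rw [norm_zero] at h1
  refine squeeze_zero_norm' ?_ h1
  have hx : ∀ᶠ k : ℤ in cofinite, (k : ℝ) ≠ x := by
    refine (Set.Subsingleton.finite ?_ : Set.Finite _)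
    intro a ha b hb
    simp only [Set.mem_compl_iff, Set.mem_ofPred_eq, not_not] at ha hb
    exact_mod_cast ha.trans hb.symm
  filter_upwards [hx] with k hk
  have hk' : x - k ≠ 0 := sub_ne_zero.mpr (Ne.symm hk)
  rw [Real.sinc_of_ne_zero (mul_ne_zero Real.pi_ne_zero hk')]
  have e : ((((-1 : ℤ) : ℂ) * x + k)⁻¹) = ((-(x - k) : ℝ) : ℂ)⁻¹ := by push_cast; ring
  rw [e, norm_inv, Complex.norm_real, norm_neg, norm_div, norm_mul, div_eq_mul_inv, mul_inv]
  have h1 : ‖Real.sin (Real.pi * (x - k))‖ ≤ 1 := Real.abs_sin_le_one _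
  have h2 : ‖Real.pi‖⁻¹ ≤ 1 := by
    rw [Real.norm_of_nonneg Real.pi_pos.le]
    exact inv_le_one_of_one_le₀ (by linarith [Real.pi_gt_three])
  calc _ ≤ 1 * (1 * ‖x - k‖⁻¹) := by gcongr
    _ = _ := by ring

open Filter Topology in
-- Each sinc term is only O(1/k), but the sine changes sign under a shift by `π`, so neighbours
-- nearly cancel and leave O(1/k²).
theorem summable_sinc_add_sinc (x : ℝ) :
    Summable (fun k : ℤ => ((Real.sinc (Real.pi * (x - k)) : ℂ) +
      Real.sinc (Real.pi * (x - (k - 1 : ℤ))))) := by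
  have h : (fun d : ℤ => (((-1 : ℤ) : ℂ) * x + d)⁻¹) =O[cofinite] fun n : ℤ => (n : ℝ)⁻¹ :=
    EisensteinSeries.linear_inv_isBigO_right (-1) x
  have h' : (fun d : ℤ => (((-1 : ℤ) : ℂ) * (x + 1 : ℝ) + d)⁻¹) =O[cofinite]
      fun n : ℤ => (n : ℝ)⁻¹ :=
    EisensteinSeries.linear_inv_isBigO_right (-1) ((x + 1 : ℝ) : ℂ)
  have hs : Summable (fun n : ℤ => (n : ℝ)⁻¹ * (n : ℝ)⁻¹) := by
    have := Real.summable_one_div_int_pow (p := 2) |>.mpr (by norm_num)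
    refine this.congr fun n => ?_
    rw [one_div, sq, mul_inv]
  refine summable_of_isBigO hs (Asymptotics.IsBigO.trans ?_ (h.mul h'))
  have hx : ∀ y : ℝ, ∀ᶠ k : ℤ in cofinite, (k : ℝ) ≠ y := by
    intro y
    refine (Set.Subsingleton.finite ?_ : Set.Finite _)
    intro a ha b hb
    simp only [Set.mem_compl_iff, Set.mem_ofPred_eq, not_not] at ha hb
    exact_mod_cast ha.trans hb.symm
  refine Asymptotics.IsBigO.of_bound 1 ?_
  filter_upwards [hx x, hx (x + 1)] with k hk hk1
  set u := x - k with hu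
  have hu0 : u ≠ 0 := sub_ne_zero.mpr (Ne.symm hk)
  have hu1 : u + 1 ≠ 0 := by
    intro h; apply hk1; linarith
  have e0 : x - ((k - 1 : ℤ) : ℝ) = u + 1 := by push_cast; ring
  have e1 : (((-1 : ℤ) : ℂ) * x + k)⁻¹ * (((-1 : ℤ) : ℂ) * (x + 1 : ℝ) + k)⁻¹ =
      ((u * (u + 1))⁻¹ : ℝ) := by
    rw [hu, ← mul_inv]; push_cast; congr 1; ring
  rw [e0, e1, ← Complex.ofReal_add, Complex.norm_real, Complex.norm_real,
    Real.sinc_of_ne_zero (mul_ne_zero Real.pi_ne_zero hu0),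
    Real.sinc_of_ne_zero (mul_ne_zero Real.pi_ne_zero hu1), mul_add, mul_one, Real.sin_add_pi]
  have e2 : Real.sin (Real.pi * u) / (Real.pi * u) + -Real.sin (Real.pi * u) / (Real.pi * u + Real.pi)
      = (Real.sin (Real.pi * u) / Real.pi) * (u * (u + 1))⁻¹ := by
    have : Real.pi * u + Real.pi ≠ 0 := by
      rw [show Real.pi * u + Real.pi = Real.pi * (u + 1) by ring]
      exact mul_ne_zero Real.pi_ne_zero hu1
    have := Real.pi_ne_zero
    field_simp
    ring
  rw [e2, norm_mul]
  gcongr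
  rw [norm_div, Real.norm_of_nonneg Real.pi_pos.le, div_le_one Real.pi_pos]
  exact (Real.abs_sin_le_one _).trans (by linarith [Real.pi_gt_three])

theorem norm_one_add_cexp_mul_I (θ : ℝ) :
    ‖1 + Complex.exp (θ * Complex.I)‖ = 2 * |Real.cos (θ / 2)| := by
  have h : 1 + Complex.exp (θ * Complex.I) =
      Complex.exp ((θ / 2 : ℝ) * Complex.I) * ((2 * Real.cos (θ / 2) : ℝ) : ℂ) := by
    push_cast
    rw [Complex.two_cos, mul_add, ← Complex.exp_add, ← Complex.exp_add, ← Complex.exp_zero, add_comm]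
    congr 2 <;> ring
  rw [h, norm_mul, Complex.norm_exp_ofReal_mul_I, Complex.norm_real, one_mul, norm_mul]
  norm_num

/-- Concavity: on `[0, π/2]` the cosine lies above its chord. -/
theorem one_sub_abs_div_pi_le_cos_half {θ : ℝ} (hθ : |θ| ≤ Real.pi) :
    1 - |θ| / Real.pi ≤ Real.cos (θ / 2) := by
  have h := Real.one_sub_mul_le_cos (x := |θ| / 2) (by positivity) (by linarith)
  rw [← Real.cos_abs (θ / 2), abs_div, abs_two]
  refine le_trans (le_of_eq ?_) h
  ring

open Filter Topology in
-- The periodic extension of `exp(ixθ)` may jump at `±π`, and its coefficients need not be summable.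
-- The factor `1 + exp(iθ)` vanishes there, giving a continuous function with summable coefficients;
-- for `|θ| < π` the factor is then divided out.
theorem tendsto_sum_sinc_mul_cexp (x : ℝ) {θ : ℝ} (hθ : |θ| < Real.pi) :
    Tendsto (fun N : ℕ => ∑ k ∈ Finset.Icc (-(N : ℤ)) N,
        (Real.sinc (Real.pi * (x - k)) : ℂ) * Complex.exp (θ * Complex.I) ^ k)
      atTop (𝓝 (Complex.exp (Complex.I * x * θ))) := by
  set w := Complex.exp (θ * Complex.I) with hw
  set c : ℤ → ℂ := fun k => (Real.sinc (Real.pi * (x - k)) : ℂ) with hc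
  have hw0 : w ≠ 0 := Complex.exp_ne_zero _
  have hw1 : ‖w‖ = 1 := Complex.norm_exp_ofReal_mul_I θ
  have h1w : 1 + w ≠ 0 := by
    rw [← norm_pos_iff, hw, norm_one_add_cexp_mul_I]
    have := one_sub_abs_div_pi_le_cos_half hθ.le
    have h2 : |θ| / Real.pi < 1 := (div_lt_one Real.pi_pos).mpr hθ
    have : 0 < Real.cos (θ / 2) := by linarith
    positivity
  have : Fact (0 < 2 * Real.pi) := ⟨Real.two_pi_pos⟩
  let g : ℝ → ℂ := fun θ => (1 + Complex.exp (θ * Complex.I)) * Complex.exp (Complex.I * x * θ)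
  have hg : Continuous g := by fun_prop
  have hgend : g (-Real.pi) = g (-Real.pi + 2 * Real.pi) := by
    have : -Real.pi + 2 * Real.pi = Real.pi := by ring
    simp [g, this, Complex.exp_neg]
  let G : C(AddCircle (2 * Real.pi), ℂ) :=
    ⟨AddCircle.liftIco (2 * Real.pi) (-Real.pi) g,
      AddCircle.liftIco_continuous hgend hg.continuousOn⟩
  have hcoeff : ∀ k : ℤ, fourierCoeff G k = c k + c (k - 1) := by
    intro k
    change fourierCoeff (AddCircle.liftIco (2 * Real.pi) (-Real.pi) g) k = _
    rw [fourierCoeff_liftIco_eq, fourierCoeffOn_eq_integral]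
    have e : ∀ θ : ℝ, fourier (-k) (θ : AddCircle (-Real.pi + 2 * Real.pi - -Real.pi)) • g θ =
        Complex.exp (Complex.I * ((x - k : ℝ) : ℂ) * θ) +
          Complex.exp (Complex.I * ((x - (k - 1 : ℤ) : ℝ) : ℂ) * θ) := by
      intro θ
      rw [fourier_coe_apply, smul_eq_mul]
      simp only [g]
      rw [add_mul, one_mul, ← Complex.exp_add, mul_add, ← Complex.exp_add, ← Complex.exp_add]
      have := Real.pi_ne_zero
      have hp : (Real.pi : ℂ) ≠ 0 := by exact_mod_cast this
      congr 2 <;>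
      · push_cast
        rw [show (-(Real.pi : ℂ) + 2 * Real.pi - -Real.pi) = 2 * Real.pi by ring]
        field_simp
        ring
    have e2 : -Real.pi + 2 * Real.pi = Real.pi := by ring
    simp_rw [e]
    rw [intervalIntegral.integral_add ((by fun_prop : Continuous _).intervalIntegrable _ _)
      ((by fun_prop : Continuous _).intervalIntegrable _ _), e2, integral_cexp_mul_I,
      integral_cexp_mul_I, ← mul_add, Complex.real_smul]
    have hp : (Real.pi : ℂ) ≠ 0 := by exact_mod_cast Real.pi_ne_zero
    simp only [hc]
    push_cast
    field_simp
    ring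
  have hsum : Summable (fourierCoeff G) := by
    rw [funext hcoeff]
    exact summable_sinc_add_sinc x
  have H := has_pointwise_sum_fourier_series_of_summable hsum (θ : AddCircle (2 * Real.pi))
  have hGθ : G (θ : AddCircle (2 * Real.pi)) = (1 + w) * Complex.exp (Complex.I * x * θ) := by
    have := abs_lt.mp hθ
    exact AddCircle.liftIco_coe_apply (f := g) ⟨this.1.le, by linarith⟩
  have hterm : ∀ k : ℤ, fourierCoeff G k • fourier k (θ : AddCircle (2 * Real.pi)) =
      (c k + c (k - 1)) * w ^ k := by
    intro k
    rw [hcoeff, fourier_coe_apply, smul_eq_mul, hw, ← Complex.exp_int_mul]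
    have hp : (Real.pi : ℂ) ≠ 0 := by exact_mod_cast Real.pi_ne_zero
    congr 2
    push_cast
    field_simp
  simp_rw [hterm] at H
  rw [hGθ] at H
  -- The sum over `ℤ` is unconditional, so it may be taken along symmetric intervals.
  have H1 := H.comp (Finset.tendsto_Icc_neg (R := ℤ))
  simp only [Function.comp_def] at H1
  have hbd : Tendsto (fun N : ℕ => c (-N - 1) * w ^ (-N : ℤ) - c N * w ^ (N + 1 : ℤ))
      atTop (𝓝 0) := by
    have hz : ∀ (u v : ℕ → ℤ), Tendsto u atTop cofinite →
        Tendsto (fun N => c (u N) * w ^ v N) atTop (𝓝 0) := by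
      intro u v hu
      rw [tendsto_zero_iff_norm_tendsto_zero]
      have := (tendsto_zero_iff_norm_tendsto_zero.mp ((tendsto_sinc_cofinite x).comp hu))
      refine this.congr fun N => ?_
      simp [hc, norm_zpow, hw1]
    have i1 : Function.Injective (fun N : ℕ => (-(N : ℤ) - 1)) := fun a b h => by
      simp only at h; omega
    have := (hz _ (fun N => -(N : ℤ)) (i1.tendsto_cofinite.mono_left Nat.cofinite_eq_atTop.ge)).sub
      (hz _ (fun N => (N : ℤ) + 1)
        (Nat.cast_injective.tendsto_cofinite.mono_left Nat.cofinite_eq_atTop.ge))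
    simpa using this
  have H2 := (H1.sub hbd).const_mul (1 + w)⁻¹
  rw [sub_zero, inv_mul_cancel_left₀ h1w] at H2
  refine H2.congr fun N => ?_
  rw [one_add_mul_sum_Icc_neg c hw0, add_sub_cancel_right, inv_mul_cancel_left₀ h1w]

/-! ### Abel summation for alternating sine sums -/

/-- Abel summation: a bound for power sums with monotone coefficients. -/
theorem norm_sum_antitone_mul_pow_le {a : ℕ → ℝ} {w : ℂ} (hw : ‖w‖ = 1) {n N : ℕ} (hnN : n < N)
    (ha : ∀ k, n < k → 0 ≤ a k) (hanti : ∀ k, n < k → a (k + 1) ≤ a k) :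
    ‖(1 - w) * ∑ k ∈ Finset.Ioc n N, (a k : ℂ) * w ^ k‖ ≤ 2 * a (n + 1) := by
  -- Keeping the boundary term on the left leaves the telescoping bound `a (n+1) + ∑ (a k - a
  -- (k+1))`, which makes the induction close.
  have key : ∀ N, n + 1 ≤ N →
      ‖(1 - w) * ∑ k ∈ Finset.Ioc n N, (a k : ℂ) * w ^ k + a N * w ^ (N + 1)‖ ≤
        2 * a (n + 1) - a N := by
    intro N hN
    induction N, hN using Nat.le_induction with
    | base =>
      rw [Finset.sum_Ioc_succ_top le_rfl, Finset.Ioc_self, Finset.sum_empty, zero_add]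
      have : (1 - w) * ((a (n + 1) : ℂ) * w ^ (n + 1)) + a (n + 1) * w ^ (n + 1 + 1) =
          a (n + 1) * w ^ (n + 1) := by ring
      rw [this, norm_mul, norm_pow, hw, Complex.norm_real,
        Real.norm_of_nonneg (ha _ (by omega))]
      simp; linarith
    | succ N hN ih =>
      rw [Finset.sum_Ioc_succ_top (by omega)]
      have : (1 - w) * (∑ k ∈ Finset.Ioc n N, (a k : ℂ) * w ^ k + a (N + 1) * w ^ (N + 1)) +
          a (N + 1) * w ^ (N + 1 + 1) =
          ((1 - w) * ∑ k ∈ Finset.Ioc n N, (a k : ℂ) * w ^ k + a N * w ^ (N + 1)) -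
            ((a N - a (N + 1) : ℝ) : ℂ) * w ^ (N + 1) := by push_cast; ring
      rw [this]
      refine (norm_sub_le _ _).trans ?_
      rw [norm_mul, norm_pow, hw, Complex.norm_real,
        Real.norm_of_nonneg (sub_nonneg.mpr (hanti N (by omega)))]
      simp; linarith
  have h := key N hnN
  have e : (1 - w) * ∑ k ∈ Finset.Ioc n N, (a k : ℂ) * w ^ k =
      ((1 - w) * ∑ k ∈ Finset.Ioc n N, (a k : ℂ) * w ^ k + a N * w ^ (N + 1)) -
        a N * w ^ (N + 1) := by ring
  rw [e]
  refine (norm_sub_le _ _).trans ?_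
  rw [norm_mul (a N : ℂ), norm_pow, hw, Complex.norm_real, Real.norm_of_nonneg (ha _ hnN)]
  simp; linarith

theorem abs_sum_antitone_mul_sin_le {a : ℕ → ℝ} {θ : ℝ} (hθ : |θ| < Real.pi) {n N : ℕ}
    (hnN : n < N) (ha : ∀ k, n < k → 0 ≤ a k) (hanti : ∀ k, n < k → a (k + 1) ≤ a k) :
    |∑ k ∈ Finset.Ioc n N, a k * ((-1) ^ k * Real.sin (k * θ))| ≤
      a (n + 1) / (1 - |θ| / Real.pi) := by
  -- The minus sign absorbs `(-1)^k`; the sum is then an imaginary part, and `1 - w = 1 + exp(iθ)`.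
  set w : ℂ := -Complex.exp (θ * Complex.I) with hw
  have hw1 : ‖w‖ = 1 := by rw [hw, norm_neg]; exact Complex.norm_exp_ofReal_mul_I θ
  have h := norm_sum_antitone_mul_pow_le hw1 hnN ha hanti
  have him : (∑ k ∈ Finset.Ioc n N, (a k : ℂ) * w ^ k).im =
      ∑ k ∈ Finset.Ioc n N, a k * ((-1) ^ k * Real.sin (k * θ)) := by
    rw [Complex.im_sum]
    refine Finset.sum_congr rfl fun k _ => ?_
    rw [Complex.im_ofReal_mul, hw, neg_pow, ← Complex.exp_nat_mul, ← mul_assoc,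
      show ((-1 : ℂ)) ^ k = (((-1 : ℝ) ^ k : ℝ) : ℂ) by push_cast; rfl, Complex.im_ofReal_mul,
      show (k : ℂ) * θ = ((k * θ : ℝ) : ℂ) by push_cast; rfl, Complex.exp_ofReal_mul_I_im]
  rw [norm_mul, hw, sub_neg_eq_add, norm_one_add_cexp_mul_I, ← hw] at h
  have hd : 0 < 1 - |θ| / Real.pi := by
    rw [sub_pos]; exact (div_lt_one Real.pi_pos).mpr hθ
  have hc := (one_sub_abs_div_pi_le_cos_half hθ.le).trans (le_abs_self _)
  rw [← him, le_div_iff₀ hd]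
  have h3 := Complex.abs_im_le_norm (∑ k ∈ Finset.Ioc n N, (a k : ℂ) * w ^ k)
  have := mul_le_mul h3 hc hd.le (norm_nonneg _)
  linarith

/-! ### Symmetric tails, split into even and odd parts -/

/-- The even part of the symmetric tail of the sampling series, up to the factor
`-2 sin(πx) / π`. -/
noncomputable def tailCos (θ : ℝ) (n N : ℕ) (x : ℝ) : ℝ :=
  ∑ k ∈ Finset.Ioc n N, x / ((k : ℝ) ^ 2 - x ^ 2) * ((-1) ^ k * Real.cos (k * θ))

/-- The odd part of the symmetric tail of the sampling series, up to the factor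
`-2 i sin(πx) / π`. -/
noncomputable def tailSin (θ : ℝ) (n N : ℕ) (x : ℝ) : ℝ :=
  ∑ k ∈ Finset.Ioc n N, (k : ℝ) / ((k : ℝ) ^ 2 - x ^ 2) * ((-1) ^ k * Real.sin (k * θ))

theorem sinc_mul_cexp_add_neg {x θ : ℝ} {k : ℕ} (h1 : x - k ≠ 0) (h2 : x + k ≠ 0) :
    (Real.sinc (Real.pi * (x - (k : ℤ))) : ℂ) * Complex.exp (θ * Complex.I) ^ (k : ℤ) +
      (Real.sinc (Real.pi * (x - (-k : ℤ))) : ℂ) * Complex.exp (θ * Complex.I) ^ (-k : ℤ) =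
    ((-(2 * Real.sin (Real.pi * x) / Real.pi) : ℝ) : ℂ) *
      ((x / ((k : ℝ) ^ 2 - x ^ 2) * ((-1) ^ k * Real.cos (k * θ)) : ℝ) +
        (((k : ℝ) / ((k : ℝ) ^ 2 - x ^ 2) * ((-1) ^ k * Real.sin (k * θ)) : ℝ) : ℂ) *
          Complex.I) := by
  have hpi := Real.pi_ne_zero
  have h3 : (k : ℝ) ^ 2 - x ^ 2 ≠ 0 := by
    rw [show (k : ℝ) ^ 2 - x ^ 2 = -((x - k) * (x + k)) by ring]
    exact neg_ne_zero.mpr (mul_ne_zero h1 h2)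
  have s1 : Real.sinc (Real.pi * (x - (k : ℤ))) =
      (-1) ^ k * Real.sin (Real.pi * x) / (Real.pi * (x - k)) := by
    rw [Int.cast_natCast, Real.sinc_of_ne_zero (mul_ne_zero hpi h1), mul_sub, mul_comm Real.pi k,
      Real.sin_sub_nat_mul_pi]
  have s2 : Real.sinc (Real.pi * (x - (-k : ℤ))) =
      (-1) ^ k * Real.sin (Real.pi * x) / (Real.pi * (x + k)) := by
    rw [Int.cast_neg, Int.cast_natCast, sub_neg_eq_add, Real.sinc_of_ne_zero (mul_ne_zero hpi h2),
      mul_add, mul_comm Real.pi k, Real.sin_add_nat_mul_pi]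
  have e1 : Complex.exp (θ * Complex.I) ^ (k : ℤ) =
      (Real.cos (k * θ) : ℂ) + Real.sin (k * θ) * Complex.I := by
    rw [← Complex.exp_int_mul, Complex.ofReal_cos, Complex.ofReal_sin, ← Complex.exp_mul_I]
    congr 1; push_cast; ring
  have e2 : Complex.exp (θ * Complex.I) ^ (-k : ℤ) =
      (Real.cos (k * θ) : ℂ) - Real.sin (k * θ) * Complex.I := by
    rw [← Complex.exp_int_mul, Complex.ofReal_cos, Complex.ofReal_sin, Complex.cos_sub_sin_I]
    congr 1; push_cast; ring
  rw [s1, s2, e1, e2]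
  apply Complex.ext
  · simp only [Complex.add_re, Complex.add_im, Complex.sub_re, Complex.sub_im, Complex.mul_re,
      Complex.mul_im, Complex.ofReal_re, Complex.ofReal_im, Complex.I_re, Complex.I_im]
    field_simp
    ring
  · simp only [Complex.add_re, Complex.add_im, Complex.sub_re, Complex.sub_im, Complex.mul_re,
      Complex.mul_im, Complex.ofReal_re, Complex.ofReal_im, Complex.I_re, Complex.I_im]
    field_simp
    ring

theorem sum_sinc_tail {x θ : ℝ} {n N : ℕ} (hnN : n ≤ N) (hx : |x| ≤ n) :
    ∑ k ∈ Finset.Icc (-(N : ℤ)) N,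
        (Real.sinc (Real.pi * (x - k)) : ℂ) * Complex.exp (θ * Complex.I) ^ k -
      ∑ k ∈ Finset.Icc (-(n : ℤ)) n,
        (Real.sinc (Real.pi * (x - k)) : ℂ) * Complex.exp (θ * Complex.I) ^ k =
    ((-(2 * Real.sin (Real.pi * x) / Real.pi) : ℝ) : ℂ) *
      (tailCos θ n N x + tailSin θ n N x * Complex.I) := by
  induction N, hnN using Nat.le_induction with
  | base => simp [tailCos, tailSin]
  | succ N hN ih =>
    have hNr : (n : ℝ) ≤ N := by exact_mod_cast hN
    have hx' := abs_le.mp hx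
    have key := sinc_mul_cexp_add_neg (x := x) (θ := θ) (k := N + 1)
      (by push_cast; linarith) (by push_cast; linarith)
    rw [sum_Icc_neg_succ, add_sub_right_comm, ih]
    have t1 : tailCos θ n (N + 1) x = tailCos θ n N x + _ := Finset.sum_Ioc_succ_top (by omega) _
    have t2 : tailSin θ n (N + 1) x = tailSin θ n N x + _ := Finset.sum_Ioc_succ_top (by omega) _
    push_cast at key t1 t2 ⊢
    rw [key, t1, t2]
    push_cast
    ring

/-- Absolute convergence suffices here: `∑_{k>n} 1/k² ≤ 1/n`. -/
theorem abs_sum_Ioc_mul_le {a b : ℕ → ℝ} {C : ℝ} {n N : ℕ} (hn : n ≠ 0) (hnN : n ≤ N) (hC : 0 ≤ C)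
    (ha : ∀ k, n < k → |a k| ≤ C / (k : ℝ) ^ 2) (hb : ∀ k, |b k| ≤ 1) :
    |∑ k ∈ Finset.Ioc n N, a k * b k| ≤ C / n := by
  calc _ ≤ ∑ k ∈ Finset.Ioc n N, |a k * b k| := Finset.abs_sum_le_sum_abs _ _
    _ ≤ ∑ k ∈ Finset.Ioc n N, C * ((k : ℝ) ^ 2)⁻¹ := by
        refine Finset.sum_le_sum fun k hk => ?_
        rw [abs_mul, ← div_eq_mul_inv]
        exact (mul_le_of_le_one_right (abs_nonneg _) (hb k)).trans (ha k (Finset.mem_Ioc.mp hk).1)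
    _ ≤ C * ((n : ℝ)⁻¹ - (N : ℝ)⁻¹) := by
        rw [← Finset.mul_sum]
        gcongr
        exact sum_Ioc_inv_sq_le_sub hn hnN
    _ ≤ C / n := by
        rw [div_eq_mul_inv]
        gcongr
        exact sub_le_self _ (by positivity)

theorem abs_neg_one_pow_mul_le_one {r : ℝ} (hr : |r| ≤ 1) (k : ℕ) : |(-1) ^ k * r| ≤ 1 := by
  rwa [abs_mul, abs_pow, abs_neg, abs_one, one_pow, one_mul]

/-! ### Tail estimates, uniform in the upper cutoff -/

section bounds

variable {x y z δ θ : ℝ} {n N k : ℕ}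

/-- The role of `z`: it keeps `x` away from the nodes beyond `n`, so every denominator is at least
`(1-z)k²`. -/
theorem one_sub_mul_sq_le (hz0 : 0 ≤ z) (hx : x ^ 2 ≤ z * n ^ 2) (hk : n ≤ k) :
    (1 - z) * (k : ℝ) ^ 2 ≤ (k : ℝ) ^ 2 - x ^ 2 := by
  have : (n : ℝ) ≤ k := by exact_mod_cast hk
  have : z * (n : ℝ) ^ 2 ≤ z * (k : ℝ) ^ 2 := by gcongr
  linarith

theorem sq_sub_sq_pos_of_lt (hz0 : 0 ≤ z) (hz1 : z < 1) (hx : x ^ 2 ≤ z * n ^ 2) (hk : n < k) :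
    0 < (k : ℝ) ^ 2 - x ^ 2 := by
  have : 0 < (k : ℝ) := by exact_mod_cast (by omega : 0 < k)
  have : 0 < (1 - z) * (k : ℝ) ^ 2 := mul_pos (by linarith) (by positivity)
  linarith [one_sub_mul_sq_le hz0 hx hk.le]

theorem div_sq_sub_sq_antitone (h : 0 < (k : ℝ) ^ 2 - x ^ 2) :
    ((k + 1 : ℕ) : ℝ) / (((k + 1 : ℕ) : ℝ) ^ 2 - x ^ 2) ≤ (k : ℝ) / ((k : ℝ) ^ 2 - x ^ 2) := by
  have hk : (0 : ℝ) ≤ k := k.cast_nonneg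
  push_cast
  rw [div_le_div_iff₀ (by nlinarith) h]
  nlinarith [sq_nonneg x]

theorem abs_tailCos_le (hz0 : 0 ≤ z) (hz1 : z < 1) (hn : n ≠ 0) (hnN : n ≤ N) (hx0 : 0 ≤ x)
    (hx : x ^ 2 ≤ z * n ^ 2) : |tailCos θ n N x| ≤ x / (1 - z) / n := by
  have h1z : 0 < 1 - z := by linarith
  refine abs_sum_Ioc_mul_le hn hnN (by positivity) (fun k hk => ?_)
    (fun k => abs_neg_one_pow_mul_le_one (Real.abs_cos_le_one _) k)
  have hp := sq_sub_sq_pos_of_lt hz0 hz1 hx hk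
  have hk0 : 0 < (k : ℝ) := by exact_mod_cast (by omega : 0 < k)
  rw [abs_of_nonneg (by positivity), div_div]
  gcongr
  exact one_sub_mul_sq_le hz0 hx hk.le

theorem abs_tailSin_le (hz0 : 0 ≤ z) (hz1 : z < 1) (hn : n ≠ 0) (hnN : n < N)
    (hx : x ^ 2 ≤ z * n ^ 2) (hδ : 0 < δ) (hθ : δ ≤ 1 - |θ| / Real.pi) :
    |tailSin θ n N x| ≤ 1 / (1 - z) / n / δ := by
  have h1z : 0 < 1 - z := by linarith
  have hn0 : 0 < (n : ℝ) := by exact_mod_cast Nat.pos_of_ne_zero hn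
  have hθ' : |θ| < Real.pi := by
    rw [← div_lt_one Real.pi_pos]; linarith
  refine (abs_sum_antitone_mul_sin_le hθ' hnN (fun k hk => ?_) (fun k hk => ?_)).trans ?_
  · have := sq_sub_sq_pos_of_lt hz0 hz1 hx hk
    positivity
  · exact div_sq_sub_sq_antitone (sq_sub_sq_pos_of_lt hz0 hz1 hx hk)
  · refine div_le_div₀ (by positivity) ?_ hδ hθ
    have h := one_sub_mul_sq_le hz0 hx (Nat.le_succ n)
    have hp := sq_sub_sq_pos_of_lt hz0 hz1 hx (Nat.lt_succ_self n)
    simp only [Nat.succ_eq_add_one] at h hp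
    rw [div_div, div_le_div_iff₀ hp (by positivity)]
    push_cast at h ⊢
    refine le_trans ?_ ((le_of_eq (by ring)).trans (h.trans (le_of_eq (by ring))))
      (b := (1 - z) * ((n : ℝ) + 1) ^ 2)
    nlinarith

theorem abs_tailCos_sub_le (hz0 : 0 ≤ z) (hz1 : z < 1) (hn : n ≠ 0) (hnN : n ≤ N) (hx0 : 0 ≤ x)
    (hy0 : 0 ≤ y) (hx : x ^ 2 ≤ z * n ^ 2) (hy : y ^ 2 ≤ z * n ^ 2) :
    |tailCos θ n N x - tailCos θ n N y| ≤
      |x - y| * (1 / (1 - z) + y * (x + y) / ((1 - z) ^ 2 * n ^ 2)) / n := by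
  have h1z : 0 < 1 - z := by linarith
  have hn0 : 0 < (n : ℝ) := by exact_mod_cast Nat.pos_of_ne_zero hn
  have e : tailCos θ n N x - tailCos θ n N y = ∑ k ∈ Finset.Ioc n N,
      (x / ((k : ℝ) ^ 2 - x ^ 2) - y / ((k : ℝ) ^ 2 - y ^ 2)) *
        ((-1) ^ k * Real.cos (k * θ)) := by
    rw [tailCos, tailCos, ← Finset.sum_sub_distrib]
    exact Finset.sum_congr rfl fun k _ => by ring
  rw [e]
  refine abs_sum_Ioc_mul_le hn hnN (by positivity) (fun k hk => ?_)
    (fun k => abs_neg_one_pow_mul_le_one (Real.abs_cos_le_one _) k)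
  have hpx := sq_sub_sq_pos_of_lt hz0 hz1 hx hk
  have hpy := sq_sub_sq_pos_of_lt hz0 hz1 hy hk
  have hlx := one_sub_mul_sq_le hz0 hx hk.le
  have hly := one_sub_mul_sq_le hz0 hy hk.le
  have hnk : (n : ℝ) ≤ k := by exact_mod_cast hk.le
  have hk0 : 0 < (k : ℝ) := by linarith
  -- The numerator `k² + xy` is split as `(k² - y²) + y(x+y)`.
  have e2 : x / ((k : ℝ) ^ 2 - x ^ 2) - y / ((k : ℝ) ^ 2 - y ^ 2) =
      (x - y) * (1 / ((k : ℝ) ^ 2 - x ^ 2) +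
        y * (x + y) / (((k : ℝ) ^ 2 - x ^ 2) * ((k : ℝ) ^ 2 - y ^ 2))) := by
    field_simp
    ring
  rw [e2, abs_mul, abs_of_nonneg (a := 1 / _ + _) (by positivity), mul_div_assoc |x - y|]
  gcongr
  rw [add_div, div_div, div_div]
  have b1 : 1 / ((k : ℝ) ^ 2 - x ^ 2) ≤ 1 / ((1 - z) * k ^ 2) := by gcongr
  have b2 : y * (x + y) / (((k : ℝ) ^ 2 - x ^ 2) * ((k : ℝ) ^ 2 - y ^ 2)) ≤
      y * (x + y) / ((1 - z) ^ 2 * n ^ 2 * k ^ 2) := by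
    refine div_le_div_of_nonneg_left (by positivity) (by positivity) ?_
    calc (1 - z) ^ 2 * (n : ℝ) ^ 2 * k ^ 2 ≤ (1 - z) ^ 2 * (k : ℝ) ^ 2 * k ^ 2 := by gcongr
      _ = ((1 - z) * (k : ℝ) ^ 2) * ((1 - z) * (k : ℝ) ^ 2) := by ring
      _ ≤ _ := by gcongr
  linarith

theorem abs_tailSin_sub_le (hz0 : 0 ≤ z) (hz1 : z < 1) (hn : n ≠ 0) (hnN : n < N) (hx0 : 0 ≤ x)
    (hy0 : 0 ≤ y) (hx : x ^ 2 ≤ z * n ^ 2) (hy : y ^ 2 ≤ z * n ^ 2) (hδ : 0 < δ)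
    (hθ : δ ≤ 1 - |θ| / Real.pi) :
    |tailSin θ n N x - tailSin θ n N y| ≤
      |x - y| * (x + y) / ((1 - z) ^ 2 * n ^ 3) / δ := by
  have h1z : 0 < 1 - z := by linarith
  have hn0 : 0 < (n : ℝ) := by exact_mod_cast Nat.pos_of_ne_zero hn
  have hθ' : |θ| < Real.pi := by
    rw [← div_lt_one Real.pi_pos]; linarith
  -- Once `x² - y²` is factored out, the coefficients are products of two positive decreasing
  -- sequences, so Abel summation applies again, now with leading term O(n⁻³).
  have e : tailSin θ n N x - tailSin θ n N y = ((x - y) * (x + y)) * ∑ k ∈ Finset.Ioc n N,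
      ((k : ℝ) / ((k : ℝ) ^ 2 - x ^ 2) * (1 / ((k : ℝ) ^ 2 - y ^ 2))) *
        ((-1) ^ k * Real.sin (k * θ)) := by
    rw [tailSin, tailSin, ← Finset.sum_sub_distrib, Finset.mul_sum]
    refine Finset.sum_congr rfl fun k hk => ?_
    have hpx := sq_sub_sq_pos_of_lt hz0 hz1 hx (Finset.mem_Ioc.mp hk).1
    have hpy := sq_sub_sq_pos_of_lt hz0 hz1 hy (Finset.mem_Ioc.mp hk).1
    field_simp
    ring
  rw [e, abs_mul, abs_mul, abs_of_nonneg (add_nonneg hx0 hy0),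
    show |x - y| * (x + y) / ((1 - z) ^ 2 * n ^ 3) / δ =
      |x - y| * (x + y) * (1 / ((1 - z) ^ 2 * n ^ 3) / δ) by ring]
  gcongr
  refine (abs_sum_antitone_mul_sin_le hθ' hnN (fun k hk => ?_) (fun k hk => ?_)).trans ?_
  · have := sq_sub_sq_pos_of_lt hz0 hz1 hx hk
    have := sq_sub_sq_pos_of_lt hz0 hz1 hy hk
    positivity
  · have hpx := sq_sub_sq_pos_of_lt hz0 hz1 hx hk
    have hpy := sq_sub_sq_pos_of_lt hz0 hz1 hy hk
    have h := div_sq_sub_sq_antitone hpx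
    have h2 : (k : ℝ) ^ 2 - y ^ 2 ≤ ((k + 1 : ℕ) : ℝ) ^ 2 - y ^ 2 := by gcongr; simp
    have hp2 := hpy.trans_le h2
    exact mul_le_mul h (one_div_le_one_div_of_le hpy h2) (by positivity) (by positivity)
  · refine div_le_div₀ (by positivity) ?_ hδ hθ
    have hlx := one_sub_mul_sq_le hz0 hx (Nat.le_succ n)
    have hly := one_sub_mul_sq_le hz0 hy (Nat.le_succ n)
    simp only [Nat.succ_eq_add_one] at hlx hly
    push_cast at hlx hly ⊢
    calc ((n : ℝ) + 1) / (((n : ℝ) + 1) ^ 2 - x ^ 2) * (1 / (((n : ℝ) + 1) ^ 2 - y ^ 2))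
        ≤ ((n : ℝ) + 1) / ((1 - z) * ((n : ℝ) + 1) ^ 2) * (1 / ((1 - z) * ((n : ℝ) + 1) ^ 2)) := by
          have hp : 0 < (1 - z) * ((n : ℝ) + 1) ^ 2 := by positivity
          have := hp.trans_le hly
          gcongr
      _ = 1 / ((1 - z) ^ 2 * ((n : ℝ) + 1) ^ 3) := by field_simp
      _ ≤ 1 / ((1 - z) ^ 2 * (n : ℝ) ^ 3) := by gcongr; linarith

end bounds

/-! ### Truncation error of the exponential and its increments -/

section kernel

variable {x y z δ θ : ℝ} {n : ℕ}

/-- The truncation error of the sampling series of `θ ↦ exp(i x θ)`. -/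
noncomputable def samplingError (θ : ℝ) (n : ℕ) (x : ℝ) : ℂ :=
  Complex.exp (Complex.I * x * θ) - ∑ k ∈ Finset.Icc (-(n : ℤ)) n,
    (Real.sinc (Real.pi * (x - k)) : ℂ) * Complex.exp (θ * Complex.I) ^ k

open Filter Topology in
theorem tendsto_tail_samplingError (hθ : |θ| < Real.pi) (hx : |x| ≤ n) :
    Tendsto (fun N : ℕ => ((-(2 * Real.sin (Real.pi * x) / Real.pi) : ℝ) : ℂ) *
      (tailCos θ n N x + tailSin θ n N x * Complex.I)) atTop (𝓝 (samplingError θ n x)) := by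
  refine ((tendsto_sum_sinc_mul_cexp x hθ).sub_const _).congr' ?_
  filter_upwards [eventually_ge_atTop n] with N hN
  exact sum_sinc_tail hN hx

theorem abs_le_of_sq_le_mul_sq (hz1 : z < 1) (hx : x ^ 2 ≤ z * n ^ 2) : |x| ≤ n := by
  refine abs_le_of_sq_le_sq ?_ n.cast_nonneg
  nlinarith [sq_nonneg (n : ℝ)]

theorem norm_add_mul_I_le (a b : ℝ) : ‖(a : ℂ) + b * Complex.I‖ ≤ |a| + |b| := by
  refine (norm_add_le _ _).trans ?_
  simp

open Filter Topology in
theorem norm_samplingError_le (hz0 : 0 ≤ z) (hz1 : z < 1) (hn : n ≠ 0) (hx0 : 0 ≤ x)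
    (hx : x ^ 2 ≤ z * n ^ 2) (hδ : 0 < δ) (hθ : δ ≤ 1 - |θ| / Real.pi) :
    ‖samplingError θ n x‖ ≤ 2 / Real.pi * (x / (1 - z) / n + 1 / (1 - z) / n / δ) := by
  have hθ' : |θ| < Real.pi := by
    rw [← div_lt_one Real.pi_pos]; linarith
  refine le_of_tendsto (tendsto_tail_samplingError hθ' (abs_le_of_sq_le_mul_sq hz1 hx)).norm ?_
  filter_upwards [eventually_gt_atTop n] with N hN
  rw [norm_mul, Complex.norm_real, norm_neg, norm_div, norm_mul, Real.norm_of_nonneg Real.pi_pos.le]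
  have h1 := abs_tailCos_le (θ := θ) hz0 hz1 hn hN.le hx0 hx
  have h2 := abs_tailSin_le hz0 hz1 hn hN hx hδ hθ
  have h3 : ‖(2 : ℝ)‖ * ‖Real.sin (Real.pi * x)‖ ≤ 2 := by
    have := Real.abs_sin_le_one (Real.pi * x)
    rw [Real.norm_eq_abs, Real.norm_eq_abs, abs_two]; linarith
  have := Real.pi_pos
  gcongr
  exact (norm_add_mul_I_le _ _).trans (add_le_add h1 h2)

open Filter Topology in
theorem norm_samplingError_sub_le (hz0 : 0 ≤ z) (hz1 : z < 1) (hn : n ≠ 0) (hx0 : 0 ≤ x)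
    (hy0 : 0 ≤ y) (hx : x ^ 2 ≤ z * n ^ 2) (hy : y ^ 2 ≤ z * n ^ 2) (hδ : 0 < δ)
    (hθ : δ ≤ 1 - |θ| / Real.pi) :
    ‖samplingError θ n x - samplingError θ n y‖ ≤
      2 / Real.pi * (Real.pi * |x - y| * (y / (1 - z) / n + 1 / (1 - z) / n / δ) +
        (|x - y| * (1 / (1 - z) + y * (x + y) / ((1 - z) ^ 2 * n ^ 2)) / n +
          |x - y| * (x + y) / ((1 - z) ^ 2 * n ^ 3) / δ)) := by
  have hθ' : |θ| < Real.pi := by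
    rw [← div_lt_one Real.pi_pos]; linarith
  have hpi := Real.pi_pos
  refine le_of_tendsto ((tendsto_tail_samplingError hθ' (abs_le_of_sq_le_mul_sq hz1 hx)).sub
    (tendsto_tail_samplingError hθ' (abs_le_of_sq_le_mul_sq hz1 hy))).norm ?_
  filter_upwards [eventually_gt_atTop n] with N hN
  have h1 := abs_tailCos_le (θ := θ) hz0 hz1 hn hN.le hy0 hy
  have h2 := abs_tailSin_le hz0 hz1 hn hN hy hδ hθ
  have h3 := abs_tailCos_sub_le (θ := θ) hz0 hz1 hn hN.le hx0 hy0 hx hy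
  have h4 := abs_tailSin_sub_le hz0 hz1 hn hN hx0 hy0 hx hy hδ hθ
  have hsin : |Real.sin (Real.pi * x) - Real.sin (Real.pi * y)| ≤ Real.pi * |x - y| := by
    have := Real.abs_sin_sub_sin_le (Real.pi * x) (Real.pi * y)
    rwa [← mul_sub, abs_mul, abs_of_pos hpi] at this
  -- Discrete product rule: one term uses the Lipschitz bound for the sine, the other `|sin| ≤ 1`.
  have e : ((-(2 * Real.sin (Real.pi * x) / Real.pi) : ℝ) : ℂ) *
        (tailCos θ n N x + tailSin θ n N x * Complex.I) -
      ((-(2 * Real.sin (Real.pi * y) / Real.pi) : ℝ) : ℂ) *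
        (tailCos θ n N y + tailSin θ n N y * Complex.I) =
      ((-(2 / Real.pi) : ℝ) : ℂ) *
        (((Real.sin (Real.pi * x) - Real.sin (Real.pi * y) : ℝ) : ℂ) *
            (tailCos θ n N y + tailSin θ n N y * Complex.I) +
          (Real.sin (Real.pi * x) : ℝ) * (((tailCos θ n N x - tailCos θ n N y : ℝ) : ℂ) +
            ((tailSin θ n N x - tailSin θ n N y : ℝ) : ℂ) * Complex.I)) := by
    push_cast; ring
  rw [e, norm_mul, Complex.norm_real, norm_neg, Real.norm_of_nonneg (by positivity)]
  gcongr
  refine (norm_add_le _ _).trans (add_le_add ?_ ?_)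
  · rw [norm_mul, Complex.norm_real]
    exact mul_le_mul hsin ((norm_add_mul_I_le _ _).trans (add_le_add h1 h2)) (norm_nonneg _)
      (by positivity)
  · rw [norm_mul, Complex.norm_real]
    refine (mul_le_of_le_one_left (norm_nonneg _) (Real.abs_sin_le_one _)).trans ?_
    exact (norm_add_mul_I_le _ _).trans (add_le_add h3 h4)

end kernel

/-! ### From second moments to uniform bounds on the band -/

section isometry

variable {Ω : Type*} [MeasurableSpace Ω] {P : Measure Ω} {X : ℝ → Ω → ℝ} {F : Measure ℝ}

theorem IsCenteredStationary.integral_mul (hX : IsCenteredStationary P X) (u v : ℝ) :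
    ∫ o, X u o * X v o ∂P = covFun P X (u - v) := by
  rw [← hX.stationary v (u - v), add_sub_cancel]

/-- The spectral isometry on finite linear combinations of the values of the process. -/
theorem IsCenteredStationary.integral_linearCombination_sq (hX : IsCenteredStationary P X)
    (hF : IsSpectralMeasure P X F) (a : ℝ →₀ ℝ) :
    ∫ o, (Finsupp.linearCombination ℝ X a o) ^ 2 ∂P =
      ∫ l, ‖Finsupp.linearCombination ℝ (fun u l : ℝ => Complex.exp (Complex.I * u * l)) a l‖ ^ 2
        ∂F := by
  have := hF.1
  have hint : ∀ τ : ℝ, Integrable (fun l : ℝ => Complex.exp (Complex.I * τ * l)) F := by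
    intro τ
    refine Integrable.of_bound (by fun_prop) 1 (ae_of_all _ fun l => ?_)
    rw [show Complex.I * τ * l = ((τ * l : ℝ) : ℂ) * Complex.I by push_cast; ring,
      Complex.norm_exp_ofReal_mul_I]
  have hmul : ∀ u v : ℝ, Integrable (fun o => X u o * X v o) P := fun u v =>
    (hX.memLp_two u).integrable_mul (hX.memLp_two v)
  have hl : ∀ o, (Finsupp.linearCombination ℝ X a o) ^ 2 =
      ∑ u ∈ a.support, ∑ v ∈ a.support, a u * a v * (X u o * X v o) := by
    intro o
    rw [Finsupp.linearCombination_apply, Finsupp.sum, Finset.sum_apply, sq, Finset.sum_mul_sum]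
    refine Finset.sum_congr rfl fun u _ => Finset.sum_congr rfl fun v _ => ?_
    simp only [Pi.smul_apply, smul_eq_mul]; ring
  have hr : ∀ l : ℝ, ((‖Finsupp.linearCombination ℝ
        (fun u l : ℝ => Complex.exp (Complex.I * u * l)) a l‖ ^ 2 : ℝ) : ℂ) =
      ∑ u ∈ a.support, ∑ v ∈ a.support,
        ((a u * a v : ℝ) : ℂ) * Complex.exp (Complex.I * ((u - v : ℝ) : ℂ) * l) := by
    intro l
    rw [Complex.ofReal_pow, ← Complex.mul_conj', Finsupp.linearCombination_apply, Finsupp.sum,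
      Finset.sum_apply, map_sum, Finset.sum_mul_sum]
    refine Finset.sum_congr rfl fun u _ => Finset.sum_congr rfl fun v _ => ?_
    simp only [Pi.smul_apply, Complex.real_smul, map_mul, Complex.conj_ofReal]
    rw [← Complex.exp_conj, mul_mul_mul_comm, ← Complex.exp_add, ← Complex.ofReal_mul]
    congr 2
    simp only [map_mul, Complex.conj_I, Complex.conj_ofReal]
    push_cast; ring
  simp_rw [hl]
  rw [integral_finsetSum _ fun u _ => integrable_finsetSum _ fun v _ =>
    (hmul u v).const_mul _]
  -- Both sides are real, but the single exponentials in the double sum are not, so terms are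
  -- compared in `ℂ`.
  apply Complex.ofReal_injective
  rw [← integral_complex_ofReal]
  simp_rw [hr]
  rw [integral_finsetSum _ fun u _ => integrable_finsetSum _ fun v _ => (hint (u - v)).const_mul _,
    Complex.ofReal_sum]
  refine Finset.sum_congr rfl fun u _ => ?_
  rw [integral_finsetSum _ fun v _ => (hint (u - v)).const_mul _,
    integral_finsetSum _ fun v _ => (hmul u v).const_mul _,
    Complex.ofReal_sum]
  refine Finset.sum_congr rfl fun v _ => ?_
  rw [integral_const_mul, integral_const_mul, hX.integral_mul, Complex.ofReal_mul, hF.2 (u - v)]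

theorem IsSpectralMeasure.real_univ (hF : IsSpectralMeasure P X F) :
    F.real Set.univ = covFun P X 0 := by
  have h := hF.2 0
  simp at h
  exact_mod_cast h.symm

theorem IsCenteredStationary.integral_linearCombination_sq_le (hX : IsCenteredStationary P X)
    (hF : IsSpectralMeasure P X F) {L : ℝ} (hL : F (Set.Ico (-L) L)ᶜ = 0) (a : ℝ →₀ ℝ) {C : ℝ}
    (hC : ∀ l : ℝ, |l| ≤ L →
      ‖Finsupp.linearCombination ℝ (fun u l : ℝ => Complex.exp (Complex.I * u * l)) a l‖ ≤ C) :
    ∫ o, (Finsupp.linearCombination ℝ X a o) ^ 2 ∂P ≤ covFun P X 0 * C ^ 2 := by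
  have := hF.1
  rw [hX.integral_linearCombination_sq hF, ← hF.real_univ, ← smul_eq_mul,
    ← integral_const (μ := F)]
  refine integral_mono_of_nonneg (ae_of_all _ fun l => by positivity) (integrable_const _) ?_
  have h : ∀ᵐ l ∂F, l ∈ Set.Ico (-L) L := hL
  filter_upwards [h] with l hl
  have := hC l (abs_le.mpr ⟨hl.1, hl.2.le⟩)
  gcongr

end isometry

/-! ### Rescaling, comparison of constants, conclusion -/

/-- The finitely supported coefficients of the remainder `Y_n(t)` in terms of the values of the
process. -/
noncomputable def remainderCoeff (ω : ℝ) (n : ℕ) (t : ℝ) : ℝ →₀ ℝ :=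
  Finsupp.single t 1 - ∑ k ∈ Finset.Icc (-(n : ℤ)) (n : ℤ),
    Finsupp.single (k * Real.pi / ω) (Real.sinc (ω * (t - k * Real.pi / ω)))

theorem linearCombination_remainderCoeff {Ω : Type*} (X : ℝ → Ω → ℝ) (ω : ℝ) (n : ℕ) (t : ℝ)
    (o : Ω) : Finsupp.linearCombination ℝ X (remainderCoeff ω n t) o = remainder X ω n t o := by
  simp [remainderCoeff, remainder, truncSum, map_sub, map_sum, Finset.sum_apply]

theorem linearCombination_cexp_remainderCoeff {ω : ℝ} (hω : ω ≠ 0) (n : ℕ) (t l : ℝ) :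
    Finsupp.linearCombination ℝ (fun u l : ℝ => Complex.exp (Complex.I * u * l))
      (remainderCoeff ω n t) l = samplingError (Real.pi * l / ω) n (ω * t / Real.pi) := by
  have hpi : (Real.pi : ℂ) ≠ 0 := by exact_mod_cast Real.pi_ne_zero
  have hω' : (ω : ℂ) ≠ 0 := by exact_mod_cast hω
  rw [remainderCoeff, samplingError, map_sub, map_sum, Pi.sub_apply, Finset.sum_apply]
  congr 1
  · rw [Finsupp.linearCombination_single, one_smul]
    congr 1
    push_cast
    field_simp
  · refine Finset.sum_congr rfl fun k _ => ?_
    rw [Finsupp.linearCombination_single, Pi.smul_apply, Complex.real_smul,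
      ← Complex.exp_int_mul]
    congr 2
    · have := Real.pi_ne_zero
      congr 1
      field_simp
    · push_cast
      field_simp

/-- The assumed lower bound on `n` says `x ≤ n√z` for `x = ωt/π`; positivity of `t` rules out `n =
0`. -/
theorem sq_mul_div_pi_le {ω t z : ℝ} {n : ℕ} (hω : 0 < ω) (ht : 0 < t) (hz : 0 < z)
    (h : ω * t / (Real.pi * Real.sqrt z) ≤ n) :
    n ≠ 0 ∧ (ω * t / Real.pi) ^ 2 ≤ z * (n : ℝ) ^ 2 := by
  have hpi := Real.pi_pos
  have hsz := Real.sqrt_pos.mpr hz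
  constructor
  · rintro rfl
    have : 0 < ω * t / (Real.pi * Real.sqrt z) := by positivity
    simp at h
    linarith
  · rw [← div_div, div_le_iff₀ hsz] at h
    calc (ω * t / Real.pi) ^ 2 ≤ (n * Real.sqrt z) ^ 2 := by gcongr
      _ = z * (n : ℝ) ^ 2 := by rw [mul_pow, Real.sq_sqrt hz.le, mul_comm]

theorem one_sub_div_le_of_abs_le {ω L l : ℝ} (hω : 0 < ω) (hl : |l| ≤ L) :
    1 - L / ω ≤ 1 - |Real.pi * l / ω| / Real.pi := by
  have hpi := Real.pi_pos
  rw [abs_div, abs_mul, abs_of_pos hpi, abs_of_pos hω,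
    show Real.pi * |l| / ω / Real.pi = |l| / ω by field_simp]
  gcongr

theorem samplingError_bound_le_boundC {ω t z δ : ℝ} {n : ℕ} (hω : 0 < ω) (ht : 0 < t)
    (hz0 : 0 < z) (hz1 : z < 1) (hδ : 0 < δ) :
    2 / Real.pi * (ω * t / Real.pi / (1 - z) / n + 1 / (1 - z) / n / δ) ≤
      (n : ℝ)⁻¹ * (4 * ω * t / (Real.pi ^ 2 * (1 - z)) +
        4 * (z + 1 + 1 / (n : ℝ)) / (Real.pi * (1 - z) ^ 2 * δ)) := by
  have hpi := Real.pi_pos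
  have h1z : 0 < 1 - z := by linarith
  rw [show 2 / Real.pi * (ω * t / Real.pi / (1 - z) / n + 1 / (1 - z) / n / δ) =
    (n : ℝ)⁻¹ * (2 * ω * t / (Real.pi ^ 2 * (1 - z)) +
      2 * (1 - z) / (Real.pi * (1 - z) ^ 2 * δ)) by field_simp]
  have : 0 ≤ 1 / (n : ℝ) := by positivity
  gcongr <;> linarith

theorem samplingError_sub_bound_le {ω t s z δ : ℝ} {n : ℕ} (hω : 0 < ω) (ht : 0 < t) (hs : 0 < s)
    (hn : n ≠ 0) (hz0 : 0 < z) (hz1 : z < 1) (hδ : 0 < δ) :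
    2 / Real.pi * (Real.pi * |ω * t / Real.pi - ω * s / Real.pi| *
          (ω * s / Real.pi / (1 - z) / n + 1 / (1 - z) / n / δ) +
        (|ω * t / Real.pi - ω * s / Real.pi| * (1 / (1 - z) +
            ω * s / Real.pi * (ω * t / Real.pi + ω * s / Real.pi) / ((1 - z) ^ 2 * n ^ 2)) / n +
          |ω * t / Real.pi - ω * s / Real.pi| * (ω * t / Real.pi + ω * s / Real.pi) /
            ((1 - z) ^ 2 * n ^ 3) / δ)) ≤
      |t - s| / n * (boundW ω z n t s + boundQ ω z n t s / δ) := by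
  have hpi := Real.pi_pos
  have h1z : 0 < 1 - z := by linarith
  have hn1 : (1 : ℝ) ≤ n := by exact_mod_cast Nat.one_le_iff_ne_zero.mpr hn
  have hn0 : (0 : ℝ) < n := by linarith
  have e : |ω * t / Real.pi - ω * s / Real.pi| = ω / Real.pi * |t - s| := by
    rw [show ω * t / Real.pi - ω * s / Real.pi = ω / Real.pi * (t - s) by ring, abs_mul,
      abs_of_pos (by positivity)]
  rw [e, boundW, boundQ]
  set d := |t - s|
  have hd : 0 ≤ d := abs_nonneg _
  -- The shape matches the target term by term; the `0` stands opposite `n⁻¹`.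
  have e2 : 2 / Real.pi * (Real.pi * (ω / Real.pi * d) *
          (ω * s / Real.pi / (1 - z) / n + 1 / (1 - z) / n / δ) +
        ((ω / Real.pi * d) * (1 / (1 - z) +
            ω * s / Real.pi * (ω * t / Real.pi + ω * s / Real.pi) / ((1 - z) ^ 2 * n ^ 2)) / n +
          (ω / Real.pi * d) * (ω * t / Real.pi + ω * s / Real.pi) /
            ((1 - z) ^ 2 * n ^ 3) / δ)) =
      d / n * (2 * ω / (Real.pi ^ 2 * (1 - z)) *
          (ω * s + 1 + ω ^ 2 * (s + t) * s / (Real.pi ^ 2 * (n : ℝ) ^ 2 * (1 - z))) +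
        2 * ω / (Real.pi * (1 - z) ^ 2) *
          ((1 - z) + 0 + ω * (s + t) / (n * (n * Real.pi ^ 2))) / δ) := by
    field_simp
    ring
  rw [e2]
  have hfrac : ω * (s + t) / (n * (n * Real.pi ^ 2)) ≤ 2 * ω * (s + t) / (n * Real.pi ^ 2) := by
    apply div_le_div₀ (by positivity) ?_ (by positivity) (le_mul_of_one_le_left (by positivity) hn1)
    nlinarith [mul_pos hω (add_pos hs ht)]
  gcongr
  · linarith
  · linarith
  · positivity

theorem theorem1 {Ω : Type*} [MeasurableSpace Ω] (P : Measure Ω) [IsProbabilityMeasure P]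
    (X : ℝ → Ω → ℝ) (hX : IsCenteredStationary P X)
    (L : ℝ) (hL : 0 < L) (hband : IsBandlimited P X L)
    (ω : ℝ) (hω : L < ω)
    (z : ℝ) (hz : z ∈ Set.Ioo (0 : ℝ) 1) (t s : ℝ) (ht : 0 < t) (hs : 0 < s) :
    (∀ n : ℕ, ω * t / (Real.pi * Real.sqrt z) ≤ (n : ℝ) →
      ∫ o, |X t o - truncSum X ω n t o| ^ 2 ∂P
        ≤ ((n : ℝ) ^ 2)⁻¹ * boundC (covFun P X 0) L ω z n t) ∧
    (∀ n : ℕ, ω / (Real.pi * Real.sqrt z) * max t s ≤ (n : ℝ) →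
      ∫ o, (remainder X ω n t o - remainder X ω n s o) ^ 2 ∂P
        ≤ ((t - s) / (n : ℝ)) ^ 2 * boundb (covFun P X 0) L ω z n t s) := by
  obtain ⟨F, hF, hFL⟩ := hband
  obtain ⟨hz0, hz1⟩ := hz
  have hω0 : 0 < ω := hL.trans hω
  have hδ : 0 < 1 - L / ω := by rw [sub_pos]; exact (div_lt_one hω0).mpr hω
  have hpi := Real.pi_pos
  constructor
  · intro n hn
    obtain ⟨hn0, hx⟩ := sq_mul_div_pi_le hω0 ht hz0 hn
    have h := hX.integral_linearCombination_sq_le hF hFL (remainderCoeff ω n t) fun l hl => by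
      rw [linearCombination_cexp_remainderCoeff hω0.ne']
      exact (norm_samplingError_le hz0.le hz1 hn0 (by positivity) hx hδ
        (one_sub_div_le_of_abs_le hω0 hl)).trans
          (samplingError_bound_le_boundC hω0 ht hz0 hz1 hδ)
    simp_rw [linearCombination_remainderCoeff] at h
    simp_rw [sq_abs]
    refine h.trans (le_of_eq ?_)
    rw [boundC, mul_pow, inv_pow]
    ring
  · intro n hn
    have hsz := Real.sqrt_pos.mpr hz0
    obtain ⟨hn0, hx⟩ := sq_mul_div_pi_le hω0 ht hz0 (le_trans (by
      rw [mul_div_right_comm]; gcongr; exact le_max_left t s) hn)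
    obtain ⟨-, hy⟩ := sq_mul_div_pi_le hω0 hs hz0 (le_trans (by
      rw [mul_div_right_comm]; gcongr; exact le_max_right t s) hn)
    -- By linearity, the difference of coefficient vectors represents the increment both in the
    -- process and in the exponentials.
    have h := hX.integral_linearCombination_sq_le hF hFL
      (remainderCoeff ω n t - remainderCoeff ω n s) fun l hl => by
        rw [map_sub, Pi.sub_apply, linearCombination_cexp_remainderCoeff hω0.ne',
          linearCombination_cexp_remainderCoeff hω0.ne']
        exact (norm_samplingError_sub_le hz0.le hz1 hn0 (by positivity) (by positivity) hx hy hδ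
          (one_sub_div_le_of_abs_le hω0 hl)).trans
            (samplingError_sub_bound_le hω0 ht hs hn0 hz0 hz1 hδ)
    simp_rw [map_sub, Pi.sub_apply, linearCombination_remainderCoeff] at h
    refine h.trans (le_of_eq ?_)
    rw [boundb, mul_pow, div_pow, sq_abs, div_pow]
    ring
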